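/- Let $q\ge 2$ and $p\in(1,\infty)$. On $\mathbb{R}^q$ let $\langle\cdot,\cdot\rangle$ be the Euclidean inner product, $\|y\|_p=(\sum_i|y_i|^p)^{1/p}$, and let $\delta_H(\cdot,\cdot;\|\cdot\|_p)$ be the Hausdorff distance with respect to $\|\cdot\|_p$. A convex vector optimization problem is given by a closed, solid (nonempty interior), pointed, nontrivial polyhedral convex cone $C\subset\mathbb{R}^q$, a nonempty compact convex set $X\subset\mathbb{R}^n$ with $\operatorname{int}X\ne\emptyset$, and a continuous map $\Gamma:X\to\mathbb{R}^q$ that is $C$-convex, i.e. $t\Gamma(x)+(1-t)\Gamma(x')-\Gamma(tx+(1-t)x')\in C$ for all $x,x'\in X$, $t\in[0,1]$. Its upper image is $\mathcal{P}=\Gamma(X)+C$. With $C^+=\{w:\langle w,c\rangle\ge 0\ \forall c\in C\}$, a slice of $\mathcal{P}$ is a set $A=\mathcal{P}\cap\{y:\beta\le\langle\bar w,y\rangle\le\gamma\}$ with $\bar w\in\operatorname{int}C^+$, $-\infty\le\beta$ and $\gamma\in\mathbb{R}$. For a compact convex set $A$ with nonempty interior and $w\ne 0$, let $H(w,A)=\{y:\langle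 w,y\rangle\le\max_{a\in A}\langle w,a\rangle\}$. The norm-minimization algorithm with $\ell_p$ scalarization (run without a stopping tolerance) generates polytopes $P_0\supseteq P_1\supseteq\dots\supseteq A$ as follows. $P_0$ is a bounded intersection of finitely many supporting halfspaces $H(w,A)$, $w\neq0$. For a vertex $v$ of $P_k$ put $y^v=\arg\min_{y\in A}\|y-v\|_p$ and $z^v=y^v-v$. In step $k$ choose a vertex $v^k$ of $P_k$ maximizing $\|z^v\|_p$ over all vertices $v$ of $P_k$. If $z^{v^k}\ne0$, put $w^k=\nabla\|\cdot\|_p(z^{v^k})$, i.e. $w^k_i=|z^{v^k}_i|^{p-1}\operatorname{sgn}(z^{v^k}_i)/\|z^{v^k}\|_p^{p-1}$, and $$P_{k+1}=P_k\cap\{u:\langle w^k,u\rangle\ge\min_{a\in A}\langle w^k,a\rangle\}=P_k\cap H(-w^k,A);$$ if $z^{v^k}=0$ (so that $P_k=A$), put $P_{k+1}=P_k$. **Theorem.** Let $A\subset\mathbb{R}^q$ be a compact convex set with $\operatorname{int}A\neq\emptyset$, contained in an $\ell_p$-ball of radius $R$. There is a constant $\Lambda=\Lambda(p,q,R,A)>0$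 such that, whenever $A$ is a slice of the upper image of a convex vector optimization problem as above and $(P_k)_{k\ge0}$ is a sequence of outer approximations of $A$ generated by the norm-minimization algorithm with $\ell_p$ scalarization, $$\delta_H(P_k,A;\|\cdot\|_p)=O\bigl(k^{2/(1-q)}\bigr)\quad(k\to\infty),$$ and, more precisely, for every $\varepsilon>0$ there is $K\in\mathbb{N}$ with $$\delta_H(P_k,A;\|\cdot\|_p)\le(1+\varepsilon)\,\Lambda\,k^{2/(1-q)}\quad\text{for all }k\ge K.$$ So the rate exponent is $2$ for every $p\in(1,\infty)$. -/

import Mathlib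

namespace CVOP

/-- The space `ℝ^q`, with its Euclidean inner product and its usual topology. -/
abbrev Vec (q : ℕ) : Type := EuclideanSpace ℝ (Fin q)

/-- The `ℓ_p` norm `(∑ |y_i|^p)^(1/p)` on `ℝ^q`, for a real exponent `p`. -/
noncomputable def lpNorm {q : ℕ} (p : ℝ) (y : Vec q) : ℝ :=
  (∑ i, |y i| ^ p) ^ (1 / p)

/-- The `ℓ_p` distance from a point to a set. -/
noncomputable def lpDist {q : ℕ} (p : ℝ) (a : Vec q) (B : Set (Vec q)) : ℝ :=
  sInf ((fun b => lpNorm p (a - b)) '' B)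

/-- The Hausdorff distance with respect to the `ℓ_p` norm (for nonempty compact sets). -/
noncomputable def lpHausdorff {q : ℕ} (p : ℝ) (A B : Set (Vec q)) : ℝ :=
  max (sSup ((fun a => lpDist p a B) '' A)) (sSup ((fun b => lpDist p b A) '' B))

/-- The gradient of the `ℓ_p` norm at `z ≠ 0`:
the vector with coordinates `|z_i|^(p-1) sgn(z_i) / ‖z‖_p^(p-1)`. -/
noncomputable def lpGrad {q : ℕ} (p : ℝ) (z : Vec q) : Vec q :=
  WithLp.toLp 2 fun i => |z i| ^ (p - 1) * Real.sign (z i) / lpNorm p z ^ (p - 1)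

/-- The support function `h_A(w) = max {⟨w, y⟩ : y ∈ A}` (for nonempty compact `A`). -/
noncomputable def supportFn {q : ℕ} (A : Set (Vec q)) (w : Vec q) : ℝ :=
  sSup ((fun y => inner ℝ w y) '' A)

/-- The supporting halfspace `H(w, A) = {y : ⟨w, y⟩ ≤ h_A(w)}` with outer normal `w`. -/
def suppHalfspace {q : ℕ} (w : Vec q) (A : Set (Vec q)) : Set (Vec q) :=
  {y | inner ℝ w y ≤ supportFn A w}

/-- A convex vector optimization problem `min Γ(x)` w.r.t. `≤_C`, s.t. `x ∈ X`: the cone `C` is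
closed, solid, pointed, nontrivial and polyhedral, `X ⊆ ℝ^n` is nonempty, compact and convex with
nonempty interior, and `Γ : X → ℝ^q` is continuous and `C`-convex. -/
structure IsProblem {q n : ℕ} (C : PointedCone ℝ (Vec q)) (X : Set (Vec n))
    (Γ : Vec n → Vec q) : Prop where
  cone_closed : IsClosed (C : Set (Vec q))
  cone_solid : (interior (C : Set (Vec q))).Nonempty
  cone_pointed : ∀ y ∈ C, -y ∈ C → y = 0
  cone_ne_bot : C ≠ ⊥
  cone_ne_top : C ≠ ⊤
  cone_polyhedral : ∃ F : Finset (Vec q), (C : Set (Vec q)) = {y | ∀ a ∈ F, 0 ≤ inner ℝ a y}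
  feasible_nonempty : X.Nonempty
  feasible_compact : IsCompact X
  feasible_convex : Convex ℝ X
  feasible_interior : (interior X).Nonempty
  continuousOn : ContinuousOn Γ X
  convexOn : ∀ x ∈ X, ∀ x' ∈ X, ∀ t : ℝ, 0 ≤ t → t ≤ 1 →
    t • Γ x + (1 - t) • Γ x' - Γ (t • x + (1 - t) • x') ∈ C

/-- The upper image `Γ(X) + C`. -/
def upperImage {q n : ℕ} (C : PointedCone ℝ (Vec q)) (X : Set (Vec n))
    (Γ : Vec n → Vec q) : Set (Vec q) :=
  {y | ∃ x ∈ X, ∃ c ∈ C, y = Γ x + c}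

/-- The dual cone `C⁺ = {w : ⟨w, c⟩ ≥ 0 for all c ∈ C}`. -/
def dualCone {q : ℕ} (C : PointedCone ℝ (Vec q)) : Set (Vec q) :=
  {w | ∀ c ∈ C, 0 ≤ inner ℝ w c}

/-- The slab `{y : β ≤ ⟨w, y⟩ ≤ γ}`; for `β = ⊥` it is the halfspace `{y : ⟨w, y⟩ ≤ γ}`. -/
def slab {q : ℕ} (w : Vec q) (β : EReal) (γ : ℝ) : Set (Vec q) :=
  {y | β ≤ ((inner ℝ w y : ℝ) : EReal) ∧ inner ℝ w y ≤ γ}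

/-- `A` is a slice of the set `U` (the upper image) with respect to the cone `C`: the
intersection of `U` with a slab whose normal lies in the interior of the dual cone. -/
def IsSlice {q : ℕ} (C : PointedCone ℝ (Vec q)) (U A : Set (Vec q)) : Prop :=
  ∃ w ∈ interior (dualCone C), ∃ (β : EReal) (γ : ℝ), A = U ∩ slab w β γ

/-- `y` is an `ℓ_p`-closest point of `A` to `v`. -/
def IsNearest {q : ℕ} (p : ℝ) (A : Set (Vec q)) (v y : Vec q) : Prop :=
  y ∈ A ∧ ∀ u ∈ A, lpNorm p (y - v) ≤ lpNorm p (u - v)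

/-- `P` is a sequence of outer approximations of `A` generated by the norm-minimization algorithm
with `ℓ_p` scalarization, run without a stopping tolerance.  `P 0` is a bounded intersection of
finitely many supporting halfspaces of `A`.  In step `k` a farthest vertex `v` of `P k` is
selected, with closest point `y` in `A` and residual `z = y - v`.  If `z ≠ 0`, then `P k` is cut
with the supporting halfspace of `A` on which `⟨∇‖z‖_p, ·⟩` is at least its minimum over `A`; its
outer normal is `-∇‖z‖_p`.  If `z = 0`, the sequence stays constant from then on. -/
structure IsRun {q : ℕ} (p : ℝ) (A : Set (Vec q)) (P : ℕ → Set (Vec q)) : Prop where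
  init : ∃ W : Finset (Vec q), (∀ w ∈ W, w ≠ 0) ∧ P 0 = {y | ∀ w ∈ W, y ∈ suppHalfspace w A}
  bounded : Bornology.IsBounded (P 0)
  step : ∀ k, ∃ v y : Vec q,
    v ∈ (P k).extremePoints ℝ ∧ IsNearest p A v y ∧
    (∀ v' ∈ (P k).extremePoints ℝ, ∀ y', IsNearest p A v' y' →
      lpNorm p (y' - v') ≤ lpNorm p (y - v)) ∧
    (y - v ≠ 0 → P (k + 1) = P k ∩ suppHalfspace (-lpGrad p (y - v)) A) ∧
    (y - v = 0 → P (k + 1) = P k)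

end CVOP

/-! The rate comes from a packing argument. Let `d` be the farthest-vertex residual in step `k`.
Outer approximations only shrink, so all residuals up to step `k` are at least `d`. Each cut
supports `A` at the nearest point `y j` with unit outer normal `N j`, and a later vertex must
satisfy all earlier cuts. Push each `y j` along `N j` by at least unit length, onto the boundary of
a cube. For two steps, either the normals differ by a fixed amount, or they are almost parallel and
the later residual forces an offset of order `d` along the earlier normal. Either way the squared
distance of the lifted points is at least a constant times `min 1 d` (`min_le_norm_sq_of_normals`).

The cube boundary has dimension `q - 1`, so by pigeonhole two of the `k + 1` points lie within order
`k ^ (-1/(q-1))` (`exists_close_of_mem_cube_boundary`). Since `d` bounds the squared distance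
linearly, `d` is of order `k ^ (-2/(q-1))`. The exponent `p` enters only through norm comparisons,
hence not the rate. -/

namespace CVOP

open Filter Topology

/-! ### The `ℓ_p` norm -/

section LpNorm

variable {q : ℕ} {p : ℝ}

theorem lpNorm_nonneg (y : Vec q) : 0 ≤ lpNorm p y :=
  Real.rpow_nonneg (Finset.sum_nonneg fun _ _ => Real.rpow_nonneg (abs_nonneg _) _) _

theorem lpNorm_zero (hp : 1 < p) : lpNorm p (0 : Vec q) = 0 := by
  have h : p ≠ 0 := by linarith
  simp [lpNorm, Real.zero_rpow h, Real.zero_rpow (inv_ne_zero h)]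

theorem lpNorm_rpow (hp : 1 < p) (y : Vec q) : lpNorm p y ^ p = ∑ i, |y i| ^ p := by
  rw [lpNorm, ← Real.rpow_mul (Finset.sum_nonneg fun _ _ => Real.rpow_nonneg (abs_nonneg _) _),
    one_div_mul_cancel (by linarith), Real.rpow_one]

theorem lpNorm_neg (y : Vec q) : lpNorm p (-y) = lpNorm p y := by
  simp [lpNorm]

theorem lpNorm_sub_comm (x y : Vec q) : lpNorm p (x - y) = lpNorm p (y - x) := by
  rw [← lpNorm_neg, neg_sub]

theorem abs_apply_le_lpNorm (hp : 1 < p) (y : Vec q) (i : Fin q) : |y i| ≤ lpNorm p y := by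
  rw [← Real.rpow_le_rpow_iff (abs_nonneg _) (lpNorm_nonneg y) (by linarith : 0 < p),
    lpNorm_rpow hp]
  exact Finset.single_le_sum (f := fun i => |y i| ^ p)
    (fun _ _ => Real.rpow_nonneg (abs_nonneg _) _) (Finset.mem_univ i)

theorem lpNorm_pos (hp : 1 < p) {y : Vec q} (hy : y ≠ 0) : 0 < lpNorm p y := by
  obtain ⟨i, hi⟩ : ∃ i, y i ≠ 0 := by
    by_contra! h
    exact hy (by ext i; simp [h i])
  exact (abs_pos.2 hi).trans_le (abs_apply_le_lpNorm hp y i)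

theorem lpNorm_add_le (hp : 1 < p) (x y : Vec q) :
    lpNorm p (x + y) ≤ lpNorm p x + lpNorm p y :=
  Real.Lp_add_le Finset.univ (fun i => x i) (fun i => y i) hp.le

theorem lpNorm_smul (hp : 1 < p) {t : ℝ} (ht : 0 ≤ t) (x : Vec q) :
    lpNorm p (t • x) = t * lpNorm p x := by
  rw [← Real.rpow_left_inj (lpNorm_nonneg _) (mul_nonneg ht (lpNorm_nonneg _))
    (by linarith : p ≠ 0), Real.mul_rpow ht (lpNorm_nonneg _), lpNorm_rpow hp, lpNorm_rpow hp,
    Finset.mul_sum]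
  refine Finset.sum_congr rfl fun i _ => ?_
  rw [PiLp.smul_apply, smul_eq_mul, abs_mul, abs_of_nonneg ht, Real.mul_rpow ht (abs_nonneg _)]

theorem continuous_lpNorm (hp : 1 < p) : Continuous (lpNorm p : Vec q → ℝ) := by
  unfold lpNorm
  refine Continuous.rpow_const (continuous_finsetSum _ fun i _ => ?_)
    fun _ => Or.inr (by positivity)
  exact Continuous.rpow_const (by fun_prop) fun _ => Or.inr (by linarith)

/-- The Euclidean norm of a vector whose coordinates are bounded by `M`. -/
theorem norm_le_sqrt_mul {x : Vec q} {M : ℝ} (hM : 0 ≤ M) (h : ∀ i, |x i| ≤ M) :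
    ‖x‖ ≤ √q * M := by
  rw [EuclideanSpace.norm_eq, ← Real.sqrt_sq hM, ← Real.sqrt_mul (Nat.cast_nonneg _)]
  refine Real.sqrt_le_sqrt ?_
  calc ∑ i, ‖x i‖ ^ 2 ≤ ∑ _i : Fin q, M ^ 2 := Finset.sum_le_sum fun i _ => by
        rw [Real.norm_eq_abs]; exact pow_le_pow_left₀ (abs_nonneg _) (h i) 2
    _ = q * M ^ 2 := by simp

theorem norm_le_lpNorm (hp : 1 < p) (x : Vec q) : ‖x‖ ≤ √q * lpNorm p x :=
  norm_le_sqrt_mul (lpNorm_nonneg x) (abs_apply_le_lpNorm hp x)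

/-- The set of points within `ℓ_p` distance `d` of a point of `A`. -/
def lpThickening (p d : ℝ) (A : Set (Vec q)) : Set (Vec q) :=
  {x | ∃ a ∈ A, lpNorm p (x - a) ≤ d}

theorem convex_lpThickening (hp : 1 < p) (d : ℝ) {A : Set (Vec q)} (hA : Convex ℝ A) :
    Convex ℝ (lpThickening p d A) := by
  rintro x ⟨a, ha, hxa⟩ y ⟨b, hb, hyb⟩ s t hs ht hst
  refine ⟨s • a + t • b, hA ha hb hs ht hst, ?_⟩
  have : s • x + t • y - (s • a + t • b) = s • (x - a) + t • (y - b) := by module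
  rw [this]
  refine (lpNorm_add_le hp _ _).trans ?_
  rw [lpNorm_smul hp hs, lpNorm_smul hp ht]
  calc s * lpNorm p (x - a) + t * lpNorm p (y - b) ≤ s * d + t * d := by gcongr
    _ = d := by rw [← add_mul, hst, one_mul]

open scoped Pointwise in
theorem isClosed_lpThickening (hp : 1 < p) (d : ℝ) {A : Set (Vec q)} (hA : IsCompact A) :
    IsClosed (lpThickening p d A) := by
  have : lpThickening p d A = A + {x | lpNorm p x ≤ d} := by
    ext x
    simp only [lpThickening, Set.mem_ofPred_eq, Set.mem_add]
    constructor
    · rintro ⟨a, ha, h⟩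
      exact ⟨a, ha, x - a, h, by abel⟩
    · rintro ⟨a, ha, y, hy, rfl⟩
      exact ⟨a, ha, by simpa using hy⟩
  rw [this]
  exact (isClosed_le (continuous_lpNorm hp) continuous_const).add_left_of_isCompact hA

theorem exists_isNearest (hp : 1 < p) {A : Set (Vec q)} (hA : IsCompact A) (hne : A.Nonempty)
    (v : Vec q) : ∃ y, IsNearest p A v y := by
  obtain ⟨y, hy, h⟩ := hA.exists_isMinOn hne
    ((continuous_lpNorm hp).comp (continuous_id.sub continuous_const : Continuous (· - v))).continuousOn
  exact ⟨y, hy, fun u hu => h hu⟩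

theorem bddBelow_lpNorm_sub (x : Vec q) (A : Set (Vec q)) :
    BddBelow ((fun a => lpNorm p (x - a)) '' A) :=
  ⟨0, by rintro _ ⟨a, _, rfl⟩; exact lpNorm_nonneg _⟩

theorem lpDist_nonneg (x : Vec q) (A : Set (Vec q)) : 0 ≤ lpDist p x A :=
  Real.sInf_nonneg (by rintro _ ⟨a, _, rfl⟩; exact lpNorm_nonneg _)

theorem lpDist_le_of_mem_lpThickening {d : ℝ} {A : Set (Vec q)} {x : Vec q}
    (hx : x ∈ lpThickening p d A) : lpDist p x A ≤ d := by
  obtain ⟨a, ha, h⟩ := hx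
  exact (csInf_le (bddBelow_lpNorm_sub x A) ⟨a, ha, rfl⟩).trans h

theorem lpHausdorff_nonneg (A B : Set (Vec q)) : 0 ≤ lpHausdorff p A B :=
  le_max_of_le_left (Real.sSup_nonneg (by rintro _ ⟨a, _, rfl⟩; exact lpDist_nonneg _ _))

/-- For nested sets only the excess of the larger one matters. -/
theorem lpHausdorff_le_of_subset (hp : 1 < p) {d : ℝ} (hd : 0 ≤ d) {A B : Set (Vec q)}
    (hAB : A ⊆ B) (hBA : B ⊆ lpThickening p d A) : lpHausdorff p B A ≤ d := by
  refine max_le (Real.sSup_le ?_ hd) (Real.sSup_le ?_ hd)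
  · rintro _ ⟨b, hb, rfl⟩
    exact lpDist_le_of_mem_lpThickening (hBA hb)
  · rintro _ ⟨a, ha, rfl⟩
    exact lpDist_le_of_mem_lpThickening ⟨a, hAB ha, by rwa [sub_self, lpNorm_zero hp]⟩

/-! ### The gradient of the `ℓ_p` norm -/

theorem lpGrad_apply (z : Vec q) (i : Fin q) :
    lpGrad p z i = |z i| ^ (p - 1) * Real.sign (z i) / lpNorm p z ^ (p - 1) := rfl

theorem abs_lpGrad_apply_le_one (hp : 1 < p) {z : Vec q} (hz : z ≠ 0) (i : Fin q) :
    |lpGrad p z i| ≤ 1 := by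
  have h0 := lpNorm_pos hp hz
  rw [lpGrad_apply, abs_div, abs_mul, abs_of_nonneg (Real.rpow_nonneg (abs_nonneg _) _),
    abs_of_nonneg (Real.rpow_nonneg h0.le _), div_le_one (by positivity)]
  have hs : |Real.sign (z i)| ≤ 1 := by
    rcases Real.sign_apply_eq (z i) with h | h | h <;> simp [h]
  calc |z i| ^ (p - 1) * |Real.sign (z i)| ≤ |z i| ^ (p - 1) * 1 := by gcongr
    _ ≤ lpNorm p z ^ (p - 1) := by
      rw [mul_one]
      exact Real.rpow_le_rpow (abs_nonneg _) (abs_apply_le_lpNorm hp z i) (by linarith)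

theorem norm_lpGrad_le (hp : 1 < p) {z : Vec q} (hz : z ≠ 0) : ‖lpGrad p z‖ ≤ √q := by
  simpa using norm_le_sqrt_mul zero_le_one (abs_lpGrad_apply_le_one hp hz)

/-- Matches the derivative form in `hasDerivAt_abs_rpow`; at `x = 0` both sides vanish, even for `p
< 2`. -/
theorem abs_rpow_mul_sign (x : ℝ) : |x| ^ (p - 1) * Real.sign x = |x| ^ (p - 2) * x := by
  rcases eq_or_ne x 0 with rfl | hx
  · simp
  have h := abs_pos.2 hx
  have h1 : |x| ^ (p - 1) = |x| ^ (p - 2) * |x| := by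
    rw [← Real.rpow_add_one h.ne']; ring_nf
  have h2 : |x| * Real.sign x = x := by
    rcases lt_or_gt_of_ne hx with h | h
    · rw [abs_of_neg h, Real.sign_of_neg h]; ring
    · rw [abs_of_pos h, Real.sign_of_pos h]; ring
  rw [h1, mul_assoc, h2]

theorem inner_lpGrad (z u : Vec q) :
    inner ℝ (lpGrad p z) u = (∑ i, |z i| ^ (p - 2) * z i * u i) / lpNorm p z ^ (p - 1) := by
  rw [PiLp.inner_apply, Finset.sum_div]
  refine Finset.sum_congr rfl fun i _ => ?_
  rw [lpGrad_apply, abs_rpow_mul_sign]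
  simp only [RCLike.inner_apply, conj_trivial]
  ring

theorem inner_lpGrad_self (hp : 1 < p) {z : Vec q} (hz : z ≠ 0) :
    inner ℝ (lpGrad p z) z = lpNorm p z := by
  have h0 := lpNorm_pos hp hz
  have h : ∑ i, |z i| ^ (p - 2) * z i * z i = lpNorm p z ^ p := by
    rw [lpNorm_rpow hp]
    refine Finset.sum_congr rfl fun i _ => ?_
    rcases eq_or_ne (z i) 0 with h | h
    · simp [h, Real.zero_rpow (by linarith : p ≠ 0)]
    · have := abs_pos.2 h
      rw [mul_assoc, ← abs_mul_abs_self, ← mul_assoc, ← Real.rpow_add_one this.ne',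
        ← Real.rpow_add_one this.ne']
      ring_nf
  rw [inner_lpGrad, h, div_eq_iff (by positivity), mul_comm, ← Real.rpow_add_one h0.ne']
  ring_nf

/-- First-order optimality of an `ℓ_p`-closest point of a convex set. -/
theorem IsNearest.inner_lpGrad_nonneg (hp : 1 < p) {A : Set (Vec q)} (hA : Convex ℝ A)
    {v y : Vec q} (h : IsNearest p A v y) {a : Vec q} (ha : a ∈ A) :
    0 ≤ inner ℝ (lpGrad p (y - v)) (a - y) := by
  rw [inner_lpGrad]
  refine div_nonneg ?_ (Real.rpow_nonneg (lpNorm_nonneg _) _)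
  set z := y - v
  set u := a - y
  -- Differentiating the `p`-th power avoids the outer root. Minimality at `s = 0` makes the right
  -- slopes nonnegative.
  have hd : HasDerivAt (fun s : ℝ => ∑ i, |z i + s * u i| ^ p)
      (∑ i, p * (|z i| ^ (p - 2) * z i * u i)) 0 := by
    refine HasDerivAt.fun_sum fun i _ => ?_
    have h1 : HasDerivAt (fun s : ℝ => z i + s * u i) (u i) 0 := by
      simpa using ((hasDerivAt_id (0 : ℝ)).mul_const (u i)).const_add (z i)
    have h2 := (hasDerivAt_abs_rpow (z i) hp).comp_of_eq (0 : ℝ) h1 (by simp)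
    rw [mul_assoc p, mul_assoc p] at h2
    exact h2
  rw [← Finset.mul_sum] at hd
  refine nonneg_of_mul_nonneg_right (a := p) ?_ (by linarith)
  refine ge_of_tendsto hd.tendsto_slope_zero_right ?_
  filter_upwards [Ioo_mem_nhdsGT (zero_lt_one' ℝ)] with s hs
  simp only [zero_add, zero_mul, add_zero, smul_eq_mul]
  refine mul_nonneg (inv_nonneg.2 hs.1.le) (sub_nonneg.2 ?_)
  have hmem : (1 - s) • y + s • a ∈ A := hA h.1 ha (by linarith [hs.2]) hs.1.le (by ring)
  have hz : (1 - s) • y + s • a - v = z + s • u := by simp only [z, u]; module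
  have := Real.rpow_le_rpow (lpNorm_nonneg _) (h.2 _ hmem) (by linarith : 0 ≤ p)
  rw [hz, lpNorm_rpow hp, lpNorm_rpow hp] at this
  simpa only [PiLp.add_apply, PiLp.smul_apply, smul_eq_mul] using this

end LpNorm

/-! ### Separation of lifted boundary points and packing on the boundary of a cube -/

/-- Let `N`, `N'` be unit outer normals of a convex set at boundary points with difference `Y`.
If a point at offset `e` from the second one satisfies the supporting inequality of the first one,
then the points moved along the normals by lengths at least `1` are separated. -/
theorem min_le_norm_sq_of_normals {E : Type*} [NormedAddCommGroup E] [InnerProductSpace ℝ E]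
    {N N' Y e : E} {s s' c K d : ℝ} (hN : ‖N‖ = 1) (hN' : ‖N'‖ = 1) (hs : 1 ≤ s) (hs' : 1 ≤ s')
    (hc : 0 < c) (hK : 0 < K) (hY : 0 ≤ inner ℝ N Y) (hY' : inner ℝ N' Y ≤ 0)
    (he : inner ℝ N e ≤ inner ℝ N Y) (hce : c * d ≤ inner ℝ N' e) (hKe : ‖e‖ ≤ K * d) :
    min ((c / (2 * K)) ^ 2) (c * d) ≤ ‖Y + (s • N - s' • N')‖ ^ 2 := by
  have h1 : ‖Y + (s • N - s' • N')‖ ^ 2 =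
      ‖Y‖ ^ 2 + 2 * (s * inner ℝ N Y - s' * inner ℝ N' Y) +
        (s ^ 2 + s' ^ 2 - 2 * (s * s') * inner ℝ N N') := by
    rw [norm_add_sq_real, norm_sub_sq_real, inner_sub_right, inner_smul_right, inner_smul_right,
      inner_smul_left, inner_smul_right, norm_smul, norm_smul, hN, hN', real_inner_comm N Y,
      real_inner_comm N' Y, mul_one, mul_one, Real.norm_eq_abs, Real.norm_eq_abs, sq_abs, sq_abs]
    simp only [conj_trivial]
    ring
  have h2 : ‖N - N'‖ ^ 2 = 2 - 2 * inner ℝ N N' := by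
    rw [norm_sub_sq_real, hN, hN']; ring
  -- The part without `Y` is `(s - s')² + 2ss'(1 - ⟨N, N'⟩)`, and `ss' ≥ 1`.
  have h3 : ‖N - N'‖ ^ 2 + 2 * inner ℝ N Y ≤ ‖Y + (s • N - s' • N')‖ ^ 2 := by
    rw [h1]
    have hρ : 0 ≤ 1 - inner ℝ N N' := by
      have := sq_nonneg ‖N - N'‖
      linarith
    have hss : 0 ≤ s * s' - 1 := by nlinarith
    have ha : 0 ≤ (s - 1) * inner ℝ N Y := mul_nonneg (by linarith) hY
    have hb : 0 ≤ s' * -inner ℝ N' Y := mul_nonneg (by linarith) (by linarith)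
    nlinarith [mul_nonneg hss hρ, sq_nonneg (s - s'), sq_nonneg ‖Y‖]
  refine le_trans ?_ h3
  -- For nearly parallel normals, `⟨N, Y⟩ ≥ ⟨N, e⟩ ≥ cd - cd/2`.
  rcases le_total (c / (2 * K)) ‖N - N'‖ with h | h
  · refine (min_le_left _ _).trans ?_
    have : (c / (2 * K)) ^ 2 ≤ ‖N - N'‖ ^ 2 := pow_le_pow_left₀ (by positivity) h 2
    linarith
  · refine (min_le_right _ _).trans ?_
    have h4 : |inner ℝ (N' - N) e| ≤ ‖N' - N‖ * ‖e‖ := abs_real_inner_le_norm _ _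
    rw [norm_sub_rev] at h4
    have h5 : ‖N - N'‖ * ‖e‖ ≤ c / (2 * K) * (K * d) := by gcongr
    have h6 : c / (2 * K) * (K * d) = c * d / 2 := by field_simp
    rw [inner_sub_left] at h4
    have := le_abs_self (inner ℝ N' e - inner ℝ N e)
    nlinarith [sq_nonneg ‖N - N'‖]

/-- The interval `[-L, L]` splits into `m` cells of length `2 * L / m`. -/
theorem exists_cell {L : ℝ} (hL : 0 < L) {m : ℕ} (hm : 0 < m) :
    ∃ f : ℝ → Fin m, ∀ x y, |x| ≤ L → |y| ≤ L → f x = f y → |x - y| ≤ 2 * L / m := by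
  have hm' : (0 : ℝ) < m := by exact_mod_cast hm
  -- The cap puts the endpoint `x = L` into the last cell.
  let g : ℝ → ℕ := fun x => min ⌊(x + L) * m / (2 * L)⌋₊ (m - 1)
  have key : ∀ x, |x| ≤ L → (g x : ℝ) ≤ (x + L) * m / (2 * L) ∧
      (x + L) * m / (2 * L) ≤ g x + 1 := by
    intro x hx
    have hx := abs_le.1 hx
    have h0 : 0 ≤ (x + L) * m / (2 * L) :=
      div_nonneg (mul_nonneg (by linarith) hm'.le) (by linarith)
    have h1 : (x + L) * m / (2 * L) ≤ m := by
      rw [div_le_iff₀ (by linarith)]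
      nlinarith
    constructor
    · exact (Nat.cast_le.2 (min_le_left _ _)).trans (Nat.floor_le h0)
    · rcases min_choice ⌊(x + L) * m / (2 * L)⌋₊ (m - 1) with h | h
      · simp only [g, h]
        exact (Nat.lt_floor_add_one _).le
      · simp only [g, h]
        rw [Nat.cast_sub hm]
        simpa using h1
  refine ⟨fun x => ⟨g x, (min_le_right _ _).trans_lt (by omega)⟩, fun x y hx hy h => ?_⟩
  have h : g x = g y := by simpa using h
  have hx := key x hx
  have hy := key y hy
  rw [h] at hx
  have e : x - y = ((x + L) * m / (2 * L) - (y + L) * m / (2 * L)) * (2 * L / m) := by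
    field_simp; ring
  rw [e, abs_mul, abs_of_pos (by positivity : 0 < 2 * L / m)]
  refine mul_le_of_le_one_left (by positivity) (abs_le.2 ⟨by linarith, by linarith⟩)

/-- Among more than `2 * (r + 1) * m ^ r` points on the boundary of the cube `[-L, L] ^ (r + 1)`
two have all coordinates within `2 * L / m` of each other. -/
theorem exists_close_of_mem_cube_boundary {r : ℕ} {L : ℝ} (hL : 0 < L) {m : ℕ} (hm : 0 < m)
    {ι : Type*} [Fintype ι] (hcard : 2 * (r + 1) * m ^ r < Fintype.card ι) (b : ι → Vec (r + 1))
    (hb : ∀ k i, |b k i| ≤ L) (hb' : ∀ k, ∃ i, |b k i| = L) :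
    ∃ j k, j ≠ k ∧ ∀ i, |b j i - b k i| ≤ 2 * L / m := by
  obtain ⟨f, hf⟩ := exists_cell hL hm
  choose l hl using hb'
  -- The label records a face (coordinate and sign) and the cells of the other `r` coordinates.
  let F : ι → (Fin (r + 1) × Bool) × (Fin r → Fin m) :=
    fun k => ((l k, decide (b k (l k) = L)), fun i => f (b k ((l k).succAbove i)))
  obtain ⟨j, k, hne, h⟩ := Fintype.exists_ne_map_eq_of_card_lt F (by
    simp only [Fintype.card_prod, Fintype.card_fin, Fintype.card_bool, Fintype.card_pi,
      Finset.prod_const, Finset.card_univ]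
    linarith)
  refine ⟨j, k, hne, fun i => ?_⟩
  simp only [F, Prod.mk.injEq, decide_eq_decide] at h
  obtain ⟨⟨hlk, hs⟩, hc⟩ := h
  rcases Fin.eq_self_or_eq_succAbove (l j) i with rfl | ⟨i', rfl⟩
  · have hj := hl j
    have hk := hl k
    rw [← hlk] at hk hs
    have : b j (l j) = b k (l j) := by
      rcases eq_or_eq_neg_of_abs_eq hj with h1 | h1 <;>
        rcases eq_or_eq_neg_of_abs_eq hk with h2 | h2
      · rw [h1, h2]
      · rw [h1, hs.1 h1]
      · rw [h2, hs.2 h2]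
      · rw [h1, h2]
    rw [this, sub_self, abs_zero]
    positivity
  · have := congrFun hc i'
    rw [← hlk] at this
    exact hf _ _ (hb _ _) (hb _ _) this

/-- A ray that starts inside the cube `[-L, L] ^ q` meets its boundary. -/
theorem exists_smul_mem_cube_boundary {q : ℕ} {L : ℝ} {y N : Vec q} (hN : N ≠ 0)
    (hy : ∀ i, |(y + N) i| ≤ L) (hL : 0 ≤ L) :
    ∃ s : ℝ, 1 ≤ s ∧ (∀ i, |(y + s • N) i| ≤ L) ∧ ∃ i, |(y + s • N) i| = L := by
  obtain ⟨i₀, hi₀⟩ : ∃ i, N i ≠ 0 := by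
    by_contra! h
    exact hN (by ext i; simp [h i])
  have hq : Nonempty (Fin q) := ⟨i₀⟩
  -- `WithLp.ofLp` switches to the sup norm, whose sphere is the cube boundary.
  have hcont : Continuous fun s : ℝ => ‖WithLp.ofLp (y + s • N)‖ := by fun_prop
  have h1 : ‖WithLp.ofLp (y + (1 : ℝ) • N)‖ ≤ L := by
    rw [one_smul]
    exact (pi_norm_le_iff_of_nonneg hL).2 hy
  have habs := abs_pos.2 hi₀
  set S := 1 + 2 * L / |N i₀|
  have hS : 1 ≤ S := le_add_of_nonneg_right (by positivity)
  have h2 : L ≤ ‖WithLp.ofLp (y + S • N)‖ := by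
    refine le_trans ?_ (norm_le_pi_norm _ i₀)
    have e : (y + S • N) i₀ = (y + N) i₀ + (2 * L / |N i₀|) * N i₀ := by
      simp [S]; ring
    have h3 : |(2 * L / |N i₀|) * N i₀| = 2 * L := by
      rw [abs_mul, abs_of_nonneg (by positivity)]; field_simp
    have h4 := abs_sub_abs_le_abs_sub ((2 * L / |N i₀|) * N i₀) (-(y + N) i₀)
    rw [Real.norm_eq_abs, e]
    rw [h3, abs_neg, sub_neg_eq_add, add_comm (_ * _)] at h4
    have := hy i₀
    linarith
  obtain ⟨s, hs, hsL⟩ := intermediate_value_Icc hS hcont.continuousOn ⟨h1, h2⟩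
  refine ⟨s, hs.1, fun i => hsL ▸ norm_le_pi_norm (WithLp.ofLp (y + s • N)) i, ?_⟩
  obtain ⟨i, hi⟩ := Finite.exists_max fun i => ‖(y + s • N) i‖
  refine ⟨i, le_antisymm (hsL ▸ norm_le_pi_norm (WithLp.ofLp (y + s • N)) i) ?_⟩
  rw [← hsL]
  exact (pi_norm_le_iff_of_nonempty _).2 hi

/-! ### Outer approximations generated by the algorithm -/

section Run

variable {q : ℕ} {p : ℝ} {A : Set (Vec q)}

theorem inner_le_supportFn (hA : IsCompact A) (w : Vec q) {y : Vec q} (hy : y ∈ A) :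
    inner ℝ w y ≤ supportFn A w :=
  le_csSup (hA.image (by fun_prop : Continuous fun y => inner ℝ w y)).bddAbove ⟨y, hy, rfl⟩

theorem isClosed_suppHalfspace (w : Vec q) : IsClosed (suppHalfspace w A) :=
  isClosed_le (by fun_prop) continuous_const

theorem convex_suppHalfspace (w : Vec q) : Convex ℝ (suppHalfspace w A) :=
  convex_halfSpace_le (innerₛₗ ℝ w).isLinear _

/-- A nonzero residual yields a unit outer normal of `A` at the closest point, uniformly
transversal to the residual. -/
theorem IsNearest.exists_unit_normal (hp : 1 < p) (hA : Convex ℝ A) {v y : Vec q}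
    (h : IsNearest p A v y) (hz : y - v ≠ 0) :
    ∃ N : Vec q, ‖N‖ = 1 ∧ (∀ u ∈ suppHalfspace (-lpGrad p (y - v)) A, inner ℝ N u ≤ inner ℝ N y) ∧
      1 / √q * lpNorm p (y - v) ≤ inner ℝ N (v - y) := by
  have hd := lpNorm_pos hp hz
  set g := lpGrad p (y - v) with hg
  have hgz : inner ℝ g (y - v) = lpNorm p (y - v) := inner_lpGrad_self hp hz
  have hg0 : g ≠ 0 := by
    intro h0
    rw [h0, inner_zero_left] at hgz
    exact hd.ne hgz
  have hgn := norm_pos_iff.2 hg0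
  -- First-order optimality shows that `y` attains the support function; transversality follows from
  -- `⟨g, y - v⟩ = ‖y - v‖_p` and `‖g‖ ≤ √q`.
  refine ⟨‖g‖⁻¹ • -g, ?_, fun u hu => ?_, ?_⟩
  · rw [norm_smul, norm_neg, norm_inv, norm_norm, inv_mul_cancel₀ hgn.ne']
  · rw [real_inner_smul_left, real_inner_smul_left]
    refine mul_le_mul_of_nonneg_left (le_trans hu (csSup_le ⟨_, y, h.1, rfl⟩ ?_)) (by positivity)
    rintro _ ⟨a, ha, rfl⟩
    have := h.inner_lpGrad_nonneg hp hA ha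
    simp only [inner_neg_left, inner_sub_right] at this ⊢
    linarith
  · rw [real_inner_smul_left, inner_neg_left, ← inner_neg_right, neg_sub, hgz, one_div]
    have := norm_lpGrad_le hp hz
    gcongr

variable {P : ℕ → Set (Vec q)}

theorem IsRun.succ_eq (h : IsRun p A P) (k : ℕ) :
    P (k + 1) = P k ∨ ∃ w, P (k + 1) = P k ∩ suppHalfspace w A := by
  obtain ⟨v, y, -, -, -, h1, h2⟩ := h.step k
  by_cases hz : y - v = 0
  · exact Or.inl (h2 hz)
  · exact Or.inr ⟨_, h1 hz⟩

theorem IsRun.antitone (h : IsRun p A P) : Antitone P := by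
  refine antitone_nat_of_succ_le fun k => ?_
  rcases h.succ_eq k with h | ⟨w, h⟩ <;> rw [h]
  exact Set.inter_subset_left

theorem IsRun.subset (h : IsRun p A P) (hA : IsCompact A) (k : ℕ) : A ⊆ P k := by
  induction k with
  | zero =>
    obtain ⟨W, -, hW⟩ := h.init
    rw [hW]
    exact fun y hy w _ => inner_le_supportFn hA w hy
  | succ k ih =>
    rcases h.succ_eq k with h | ⟨w, h⟩ <;> rw [h]
    · exact ih
    · exact Set.subset_inter ih fun y hy => inner_le_supportFn hA w hy

theorem IsRun.convex (h : IsRun p A P) (k : ℕ) : Convex ℝ (P k) := by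
  induction k with
  | zero =>
    obtain ⟨W, -, hW⟩ := h.init
    have : P 0 = ⋂ w ∈ W, suppHalfspace w A := by rw [hW]; ext; simp
    rw [this]
    exact convex_iInter₂ fun w _ => convex_suppHalfspace w
  | succ k ih =>
    rcases h.succ_eq k with h | ⟨w, h⟩ <;> rw [h]
    · exact ih
    · exact ih.inter (convex_suppHalfspace w)

theorem IsRun.isCompact (h : IsRun p A P) (k : ℕ) : IsCompact (P k) := by
  induction k with
  | zero =>
    obtain ⟨W, -, hW⟩ := h.init
    have : P 0 = ⋂ w ∈ W, suppHalfspace w A := by rw [hW]; ext; simp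
    refine Metric.isCompact_of_isClosed_isBounded ?_ h.bounded
    rw [this]
    exact isClosed_biInter fun w _ => isClosed_suppHalfspace w
  | succ k ih =>
    rcases h.succ_eq k with h | ⟨w, h⟩ <;> rw [h]
    · exact ih
    · exact ih.inter_right (isClosed_suppHalfspace w)

/-- If all vertices of `P k` are within `d` of `A`, then so is all of `P k`. -/
theorem IsRun.subset_lpThickening (hp : 1 < p) (hA : IsCompact A) (hAc : Convex ℝ A)
    (hne : A.Nonempty) (h : IsRun p A P) (k : ℕ) {d : ℝ}
    (hd : ∀ v ∈ (P k).extremePoints ℝ, ∀ y, IsNearest p A v y → lpNorm p (y - v) ≤ d) :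
    P k ⊆ lpThickening p d A := by
  -- Krein–Milman: a closed convex set containing the vertices contains `P k`.
  rw [← closure_convexHull_extremePoints (h.isCompact k) (h.convex k)]
  refine closure_minimal (convexHull_min (fun v hv => ?_) (convex_lpThickening hp d hAc))
    (isClosed_lpThickening hp d hA)
  obtain ⟨y, hy⟩ := exists_isNearest hp hA hne v
  exact ⟨y, hy.1, by rw [lpNorm_sub_comm]; exact hd v hv y hy⟩

end Run

/-! ### Packing bound for the residuals and the resulting rate -/

/-- The largest vertex residual of the `k`-th approximation, bounded by a packing argument: `m` is
the number of subdivisions of each edge of a cube that contains the unit neighbourhood of `A`. -/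
theorem IsRun.exists_bound {r : ℕ} {p : ℝ} (hp : 1 < p) {A : Set (Vec (r + 1))}
    (hA : IsCompact A) (hAc : Convex ℝ A) (hne : A.Nonempty) {L : ℝ} (hL : 0 < L)
    (hAL : ∀ a ∈ A, ‖a‖ + 1 ≤ L) {P : ℕ → Set (Vec (r + 1))} (h : IsRun p A P) (k : ℕ) :
    ∃ d : ℝ, 0 ≤ d ∧ lpHausdorff p (P k) A ≤ d ∧ ∀ m : ℕ, 0 < m → 2 * (r + 1) * m ^ r < k + 1 →
      min 1 d ≤ 16 * (r + 1 : ℝ) ^ 3 * L ^ 2 / m ^ 2 := by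
  choose v y hv hy hmax hcut _ using h.step
  have hthick : ∀ k, P k ⊆ lpThickening p (lpNorm p (y k - v k)) A := fun k =>
    h.subset_lpThickening hp hA hAc hne k (hmax k)
  refine ⟨lpNorm p (y k - v k), lpNorm_nonneg _,
    lpHausdorff_le_of_subset hp (lpNorm_nonneg _) (h.subset hA k) (hthick k), fun m hm hmk => ?_⟩
  set d := lpNorm p (y k - v k) with hd
  by_cases hz : y k - v k = 0
  · rw [hd, hz, lpNorm_zero hp]
    exact (min_le_right _ _).trans (by positivity)
  -- `v k` lies in `P j`, all of which is within the step-`j` residual of `A`.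
  have hmono : ∀ j ≤ k, d ≤ lpNorm p (y j - v j) := by
    intro j hj
    obtain ⟨a, ha, hle⟩ := hthick j (h.antitone hj (hv k).1)
    rw [lpNorm_sub_comm] at hle
    exact ((hy k).2 a ha).trans hle
  have hz' : ∀ j ≤ k, y j - v j ≠ 0 := by
    intro j hj h0
    have := hmono j hj
    rw [h0, lpNorm_zero hp] at this
    exact (lpNorm_pos hp hz).not_ge this
  have hN : ∀ j : Fin (k + 1), ∃ N : Vec (r + 1), ‖N‖ = 1 ∧
      (∀ u ∈ suppHalfspace (-lpGrad p (y j - v j)) A, inner ℝ N u ≤ inner ℝ N (y j)) ∧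
      1 / √((r + 1 : ℕ) : ℝ) * lpNorm p (y j - v j) ≤ inner ℝ N (v j - y j) := fun j =>
    (hy j).exists_unit_normal hp hAc (hz' j (Nat.lt_succ_iff.1 j.2))
  choose N hN1 hNs hNd using hN
  have hb : ∀ j : Fin (k + 1), ∃ s : ℝ, 1 ≤ s ∧ (∀ i, |(y j + s • N j) i| ≤ L) ∧
      ∃ i, |(y j + s • N j) i| = L := by
    intro j
    refine exists_smul_mem_cube_boundary (norm_ne_zero_iff.1 (by rw [hN1]; exact one_ne_zero))
      (fun i => ?_) hL.le
    refine (PiLp.norm_apply_le (y j + N j) i).trans ((norm_add_le _ _).trans ?_)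
    rw [hN1]
    exact hAL _ (hy j).1
  choose s hs hbL hbL' using hb
  have hq : (0 : ℝ) < ((r + 1 : ℕ) : ℝ) := by positivity
  have hsep : ∀ i j : Fin (k + 1), i < j →
      min 1 d / (2 * ((r + 1 : ℕ) : ℝ)) ^ 2 ≤
        ‖(y i + s i • N i) - (y j + s j • N j)‖ ^ 2 := by
    intro i j hij
    have hdj := hmono j (Nat.lt_succ_iff.1 j.2)
    -- As `i < j`, the vertex `v j` lies in `P (i + 1)` and so survives cut `i`.
    have hvj : v j ∈ suppHalfspace (-lpGrad p (y i - v i)) A := by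
      have := h.antitone (Nat.succ_le_iff.2 hij) (hv j).1
      rw [Nat.succ_eq_add_one, hcut i (hz' i (Nat.lt_succ_iff.1 i.2))] at this
      exact this.2
    -- With these constants `c / (2K) = 1 / (2q)`, the source of the denominator `(2q)²`.
    have key := min_le_norm_sq_of_normals (Y := y i - y j) (e := v j - y j)
      (c := 1 / √((r + 1 : ℕ) : ℝ)) (K := √((r + 1 : ℕ) : ℝ)) (d := lpNorm p (y j - v j))
      (hN1 i) (hN1 j) (hs i) (hs j) (by positivity) (by positivity)
      (by rw [inner_sub_right]; exact sub_nonneg.2 (hNs i _ (inner_le_supportFn hA _ (hy j).1)))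
      (by rw [inner_sub_right]; exact sub_nonpos.2 (hNs j _ (inner_le_supportFn hA _ (hy i).1)))
      (by rw [inner_sub_right, inner_sub_right]; linarith [hNs i _ hvj])
      (hNd j) (by rw [← lpNorm_sub_comm]; exact norm_le_lpNorm hp _)
    have e : y i - y j + (s i • N i - s j • N j) = (y i + s i • N i) - (y j + s j • N j) := by abel
    rw [e] at key
    refine le_trans (le_min ?_ ?_) key
    · rw [div_div, mul_left_comm, Real.mul_self_sqrt hq.le, div_pow, one_pow]
      gcongr
      exact min_le_left _ _
    · have h1 : (1 : ℝ) ≤ ((r + 1 : ℕ) : ℝ) := by simp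
      have h2 : √((r + 1 : ℕ) : ℝ) ≤ (2 * ((r + 1 : ℕ) : ℝ)) ^ 2 := by
        rw [Real.sqrt_le_left (by positivity)]
        nlinarith [pow_le_pow_left₀ zero_le_one h1 4, pow_le_pow_right₀ h1 (by norm_num : 1 ≤ 4)]
      rw [one_div, inv_mul_eq_div]
      refine div_le_div₀ (lpNorm_nonneg _) ((min_le_right _ _).trans hdj) (by positivity) h2
  obtain ⟨i, j, hij, hclose⟩ := exists_close_of_mem_cube_boundary hL hm
    (by simpa using hmk) (fun j : Fin (k + 1) => y j + s j • N j) hbL hbL'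
  have hdist : ‖(y i + s i • N i) - (y j + s j • N j)‖ ^ 2 ≤
      (√((r + 1 : ℕ) : ℝ) * (2 * L / m)) ^ 2 :=
    pow_le_pow_left₀ (norm_nonneg _) (norm_le_sqrt_mul (by positivity) hclose) 2
  have hfin : min 1 d / (2 * ((r + 1 : ℕ) : ℝ)) ^ 2 ≤ (√((r + 1 : ℕ) : ℝ) * (2 * L / m)) ^ 2 := by
    rcases lt_or_gt_of_ne hij with hlt | hlt
    · exact (hsep i j hlt).trans hdist
    · rw [norm_sub_rev] at hdist
      exact (hsep j i hlt).trans hdist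
  rw [div_le_iff₀ (by positivity), mul_pow, Real.sq_sqrt hq.le] at hfin
  refine hfin.trans_eq ?_
  push_cast
  field_simp
  ring

/-- For large `k` there is `m` of order `k ^ (1 / r)` such that `k + 1` points outnumber the
`2 * (r + 1) * m ^ r` cells. -/
theorem exists_nat_of_le {r : ℕ} (hr : 0 < r) {k : ℕ} (hk : 2 * (r + 1) ≤ k) :
    ∃ m : ℕ, 0 < m ∧ 2 * (r + 1) * m ^ r < k + 1 ∧
      1 / (m : ℝ) ^ 2 ≤ 4 * (2 * (r + 1 : ℝ)) ^ (2 / (r : ℝ)) * (k : ℝ) ^ (-(2 / (r : ℝ))) := by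
  have hr' : (0 : ℝ) < r := by exact_mod_cast hr
  have hk' : 2 * (r + 1 : ℝ) ≤ k := by exact_mod_cast hk
  have hc : 0 < 2 * (r + 1 : ℝ) := by positivity
  have hk0 : (0 : ℝ) < k := hc.trans_le hk'
  set x : ℝ := (k / (2 * (r + 1 : ℝ))) ^ (1 / (r : ℝ)) with hx
  have hx1 : 1 ≤ x := Real.one_le_rpow ((one_le_div hc).2 hk') (by positivity)
  have hm : 0 < ⌊x⌋₊ := Nat.floor_pos.2 hx1
  have hxr : x ^ r = k / (2 * (r + 1 : ℝ)) := by
    rw [hx, ← Real.rpow_natCast, ← Real.rpow_mul (by positivity), one_div_mul_cancel hr'.ne',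
      Real.rpow_one]
  refine ⟨⌊x⌋₊, hm, ?_, ?_⟩
  · refine Nat.lt_succ_iff.2 ?_
    have h1 : (⌊x⌋₊ : ℝ) ^ r ≤ x ^ r :=
      pow_le_pow_left₀ (Nat.cast_nonneg _) (Nat.floor_le (by positivity)) r
    rw [hxr, le_div_iff₀ hc] at h1
    have : ((2 * (r + 1) * ⌊x⌋₊ ^ r : ℕ) : ℝ) ≤ (k : ℝ) := by push_cast; linarith
    exact_mod_cast this
  -- Rounding down `x ≥ 1` loses at most a factor `2`, hence the `4` in the bound.
  · have h1 : x / 2 ≤ ⌊x⌋₊ := by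
      have := Nat.lt_floor_add_one x
      have : (1 : ℝ) ≤ ⌊x⌋₊ := by exact_mod_cast hm
      linarith
    have h2 : x ^ 2 = (k : ℝ) ^ (2 / (r : ℝ)) / (2 * (r + 1 : ℝ)) ^ (2 / (r : ℝ)) := by
      rw [hx, ← Real.rpow_natCast, ← Real.rpow_mul (by positivity), ← Real.div_rpow hk0.le hc.le]
      congr 1
      push_cast
      ring
    calc 1 / (⌊x⌋₊ : ℝ) ^ 2 ≤ 1 / (x / 2) ^ 2 := by gcongr
      _ = _ := by
        rw [div_pow, h2, Real.rpow_neg hk0.le]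
        field_simp
        ring

theorem IsRun.exists_rate {r : ℕ} (hr : 0 < r) {p : ℝ} (hp : 1 < p) {A : Set (Vec (r + 1))}
    (hA : IsCompact A) (hAc : Convex ℝ A) (hne : A.Nonempty) :
    ∃ Λ : ℝ, 0 < Λ ∧ ∀ P : ℕ → Set (Vec (r + 1)), IsRun p A P →
      ∀ᶠ k : ℕ in atTop, lpHausdorff p (P k) A ≤ Λ * (k : ℝ) ^ (-(2 / (r : ℝ))) := by
  obtain ⟨M, hM, hAM⟩ := hA.isBounded.exists_pos_norm_le
  set Λ : ℝ := 16 * (r + 1 : ℝ) ^ 3 * (M + 1) ^ 2 * (4 * (2 * (r + 1 : ℝ)) ^ (2 / (r : ℝ))) with hΛ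
  have hr' : (0 : ℝ) < r := by exact_mod_cast hr
  refine ⟨Λ, by positivity, fun P hP => ?_⟩
  -- Once the bound is below `1`, the truncation in `min 1 d` is inactive.
  have hlim : Tendsto (fun k : ℕ => Λ * (k : ℝ) ^ (-(2 / (r : ℝ)))) atTop (𝓝 0) := by
    simpa using ((tendsto_rpow_neg_atTop (by positivity : 0 < 2 / (r : ℝ))).comp
      tendsto_natCast_atTop_atTop).const_mul Λ
  filter_upwards [hlim.eventually_lt_const zero_lt_one, eventually_ge_atTop (2 * (r + 1))]
    with k hk1 hk
  obtain ⟨d, -, hle, hd⟩ := hP.exists_bound hp hA hAc hne (by positivity : 0 < M + 1)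
    (fun a ha => by linarith [hAM a ha]) k
  obtain ⟨m, hm, hmk, hm2⟩ := exists_nat_of_le hr hk
  have h1 : min 1 d ≤ Λ * (k : ℝ) ^ (-(2 / (r : ℝ))) := by
    refine (hd m hm hmk).trans ?_
    rw [hΛ, mul_assoc (16 * (r + 1 : ℝ) ^ 3 * (M + 1) ^ 2), div_eq_mul_one_div]
    gcongr
  rcases min_le_iff.1 h1 with h | h
  · exact absurd hk1 h.not_gt
  · exact hle.trans h

end CVOP

theorem mainTheorem1 (q : ℕ) (hq : 2 ≤ q) (p : ℝ) (hp : 1 < p) (R : ℝ)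
    (A : Set (CVOP.Vec q)) (hAcompact : IsCompact A) (hAconvex : Convex ℝ A)
    (hAint : (interior A).Nonempty)
    (hAball : ∃ c : CVOP.Vec q, ∀ y ∈ A, CVOP.lpNorm p (y - c) ≤ R) :
    ∃ Λ : ℝ, 0 < Λ ∧
      ∀ (n : ℕ) (C : PointedCone ℝ (CVOP.Vec q)) (X : Set (CVOP.Vec n))
        (Γ : CVOP.Vec n → CVOP.Vec q),
        CVOP.IsProblem C X Γ → CVOP.IsSlice C (CVOP.upperImage C X Γ) A →
        ∀ P : ℕ → Set (CVOP.Vec q), CVOP.IsRun p A P →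
          ((fun k : ℕ => CVOP.lpHausdorff p (P k) A) =O[Filter.atTop]
            (fun k : ℕ => (k : ℝ) ^ (2 / (1 - (q : ℝ))))) ∧
          ∀ ε : ℝ, 0 < ε → ∃ K : ℕ, ∀ k : ℕ, K ≤ k →
            CVOP.lpHausdorff p (P k) A ≤ (1 + ε) * Λ * (k : ℝ) ^ (2 / (1 - (q : ℝ))) := by
  obtain ⟨r, rfl⟩ : ∃ r, q = r + 1 := ⟨q - 1, by omega⟩
  have hexp : 2 / (1 - ((r + 1 : ℕ) : ℝ)) = -(2 / (r : ℝ)) := by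
    push_cast
    rw [sub_add_cancel_right, div_neg]
  obtain ⟨Λ, hΛ, hrate⟩ := CVOP.IsRun.exists_rate (by omega : 0 < r) hp hAcompact hAconvex
    (hAint.mono interior_subset)
  refine ⟨Λ, hΛ, fun n C X Γ _ _ P hP => ?_⟩
  rw [hexp]
  refine ⟨Asymptotics.IsBigO.of_bound Λ ?_, fun ε hε => ?_⟩
  · filter_upwards [hrate P hP] with k hk
    rwa [Real.norm_of_nonneg (CVOP.lpHausdorff_nonneg _ _), Real.norm_of_nonneg (by positivity)]
  · obtain ⟨K, hK⟩ := Filter.eventually_atTop.1 (hrate P hP)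
    refine ⟨K, fun k hk => (hK k hk).trans ?_⟩
    gcongr
    nlinarith
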